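/- Let $(X_n)_{n\ge 1}$ be real random variables on a probability space $(\Omega,\mathcal F,\mathbb P)$ that are identically distributed and pairwise positively quadrant dependent, i.e. $$\mathbb P\{X_k\le x,\,X_j\le y\}-\mathbb P\{X_k\le x\}\,\mathbb P\{X_j\le y\}\ \ge\ 0\qquad\text{for all } x,y\in\mathbb R \text{ and all positive integers } k\ne j.$$ For $u,v>0$ put $$G_{X_k,X_j}(u,v):=\int_{-v}^{v}\int_{-u}^{u}\big[\mathbb P\{X_k>x,\,X_j>y\}-\mathbb P\{X_k>x\}\,\mathbb P\{X_j>y\}\big]\,dx\,dy ,$$ and suppose that $$\sum_{1\le k<j<\infty}\frac{G_{X_k,X_j}(k,j)}{kj}<\infty .$$ Then $\mathbb E|X_1|<\infty$ if and only if $\frac1n\sum_{k=1}^{n}(X_k-\mathbb E X_1)\to 0$ almost surely as $n\to\infty$. Here the converse does not presuppose that $\mathbb E X_1$ exists: if $\frac1n\sum_{k=1}^{n}(X_k-c)\to 0$ almost surely for some real constant $c$, then $\mathbb E|X_1|<\infty$ and $c=\mathbb E X_1$. -/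

import Mathlib

open MeasureTheory ProbabilityTheory Filter Topology

/-- The random variables `X 1, X 2, X 3, …` are pairwise positively quadrant dependent:
`P(X k ≤ x, X j ≤ y) - P(X k ≤ x) P(X j ≤ y) ≥ 0` for all reals `x`, `y` and all positive
integers `k ≠ j`. -/
def PairwisePQD {Ω : Type*} [MeasurableSpace Ω] (μ : Measure Ω) (X : ℕ → Ω → ℝ) : Prop :=
  ∀ k j : ℕ, 1 ≤ k → 1 ≤ j → k ≠ j → ∀ x y : ℝ,
    0 ≤ μ.real {ω | X k ω ≤ x ∧ X j ω ≤ y} - μ.real {ω | X k ω ≤ x} * μ.real {ω | X j ω ≤ y}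

/-- `Δ(x, y) = P(U > x, V > y) - P(U > x) P(V > y)`. -/
noncomputable def quadrantDelta {Ω : Type*} [MeasurableSpace Ω] (μ : Measure Ω) (U V : Ω → ℝ)
    (x y : ℝ) : ℝ :=
  μ.real {ω | x < U ω ∧ y < V ω} - μ.real {ω | x < U ω} * μ.real {ω | y < V ω}

/-- `G_{U,V}(u, v) = ∫_{-v}^{v} ∫_{-u}^{u} [P(U > x, V > y) - P(U > x) P(V > y)] dx dy`. -/
noncomputable def quadrantG {Ω : Type*} [MeasurableSpace Ω] (μ : Measure Ω) (U V : Ω → ℝ)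
    (u v : ℝ) : ℝ :=
  ∫ y in (-v)..v, ∫ x in (-u)..u, quadrantDelta μ U V x y

/-!
Everything is phrased through the ramps `ramp a b t = max (min t b - a) 0 = ∫ x in (a, b], 1_{x < t}`.
By Hoeffding's identity (`covariance_ramp`) the covariance of two ramps is the integral of
`quadrantDelta` over a rectangle. Positive quadrant dependence makes `quadrantDelta` nonnegative
(`quadrantDelta_eq`), so the covariance of ramps rising inside `[-k, k]` and `[-j, j]` lies between
`0` and `quadrantG μ (X k) (X j) k j` (`covariance_ramp_le_quadrantG`). The summability assumption
thereby bounds `∑_{k < j} cov / (k j)` for every choice of such ramps, and two choices suffice.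

*Integrability implies the strong law.* The ramps `ramp 0 k (X k)` are the truncations
`min (X k)⁺ k`. Since `1 / j ^ 2 ≤ 1 / (k j)` for `k < j`, their covariances together with their
variances `∑ Var / k ^ 2 ≤ 3 E(X 1)⁺` satisfy the assumptions of an Etemadi type strong law for
nonnegative variables (`strong_law_of_sum_covariance_le`), and truncation is almost surely
eventually inactive. The negative parts are the positive parts of `-X k`, whose ramps have the same
covariances as reflected ramps of `X k` (`covariance_ramp_neg`).

*The strong law implies integrability.* It forces `X k / k → 0` almost surely, so the normalized
ramps `W k = ramp (k / 2) k (X k) / (k / 2)`, with values in `[0, 1]`, vanish eventually. Their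
covariances are at most `4 quadrantG / (k j)`, hence of bounded total, and a Chebyshev argument
(`exists_sum_integral_le_of_ae_eventually_eq_zero`) gives `∑ E W k < ∞`. As `W k` is at least the
indicator of `{X k > k}`, this bounds `E(X 1)⁺`; the negative part is treated in the same way. The
value of the centering constant then follows from the first direction.
-/

/-! ### Ramp functions -/

/-- The ramp of height `b - a` rising on `[a, b]`: the length of `(a, b] ∩ (-∞, t)`. -/
noncomputable def ramp (a b t : ℝ) : ℝ := max (min t b - a) 0

theorem ramp_nonneg (a b t : ℝ) : 0 ≤ ramp a b t := le_max_right _ _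

theorem ramp_le {a b : ℝ} (hab : a ≤ b) (t : ℝ) : ramp a b t ≤ b - a :=
  max_le (by linarith [min_le_right t b]) (by linarith)

theorem measurable_ramp (a b : ℝ) : Measurable (ramp a b) := by
  unfold ramp; fun_prop

theorem ramp_eq_integral (a b t : ℝ) :
    ramp a b t = ∫ x in Set.Ioc a b, (Set.Iio t).indicator (fun _ => (1 : ℝ)) x := by
  rw [integral_indicator_const _ measurableSet_Iio, smul_eq_mul, mul_one,
    measureReal_congr Iio_ae_eq_Iic, measureReal_restrict_apply measurableSet_Iic,
    Set.inter_comm, Set.Ioc_inter_Iic, Real.volume_real_Ioc, min_comm]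
  rfl

/-! ### Hoeffding's identity and domination by `quadrantG` -/

section Hoeffding

variable {Ω : Type*} [MeasurableSpace Ω] {μ : Measure Ω} [IsProbabilityMeasure μ] {U V : Ω → ℝ}

theorem memLp_ramp {a b : ℝ} (hab : a ≤ b) (hU : Measurable U) (p : ENNReal) :
    MemLp (fun ω => ramp a b (U ω)) p μ := by
  refine MemLp.of_bound ((measurable_ramp a b).comp hU).aestronglyMeasurable (b - a)
    (ae_of_all _ fun ω => ?_)
  rw [Real.norm_of_nonneg (ramp_nonneg _ _ _)]
  exact ramp_le hab _

theorem measurable_measureReal_quadrant (hU : Measurable U) (hV : Measurable V) :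
    Measurable fun z : ℝ × ℝ => μ.real {ω | z.1 < U ω ∧ z.2 < V ω} := by
  have hs : MeasurableSet {q : (ℝ × ℝ) × Ω | q.1.1 < U q.2 ∧ q.1.2 < V q.2} := by
    rw [Set.ofPred_and]
    exact (measurableSet_lt (by fun_prop) (by fun_prop)).inter
      (measurableSet_lt (by fun_prop) (by fun_prop))
  exact (measurable_measure_prodMk_left (ν := μ) hs).ennreal_toReal

theorem measurable_measureReal_lt (hU : Measurable U) :
    Measurable fun x : ℝ => μ.real {ω | x < U ω} := by
  have hs : MeasurableSet {q : ℝ × Ω | q.1 < U q.2} :=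
    measurableSet_lt (by fun_prop) (by fun_prop)
  exact (measurable_measure_prodMk_left (ν := μ) hs).ennreal_toReal

theorem integrable_measureReal_quadrant (hU : Measurable U) (hV : Measurable V)
    (ν : Measure (ℝ × ℝ)) [IsFiniteMeasure ν] :
    Integrable (fun z : ℝ × ℝ => μ.real {ω | z.1 < U ω ∧ z.2 < V ω}) ν := by
  refine Integrable.of_bound (measurable_measureReal_quadrant hU hV).aestronglyMeasurable 1
    (ae_of_all _ fun z => ?_)
  rw [Real.norm_of_nonneg measureReal_nonneg]
  exact measureReal_le_one

theorem integrable_measureReal_lt (hU : Measurable U) (ν : Measure ℝ) [IsFiniteMeasure ν] :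
    Integrable (fun x : ℝ => μ.real {ω | x < U ω}) ν := by
  refine Integrable.of_bound (measurable_measureReal_lt hU).aestronglyMeasurable 1
    (ae_of_all _ fun z => ?_)
  rw [Real.norm_of_nonneg measureReal_nonneg]
  exact measureReal_le_one

theorem integrable_quadrantDelta (hU : Measurable U) (hV : Measurable V)
    (ν₁ ν₂ : Measure ℝ) [IsFiniteMeasure ν₁] [IsFiniteMeasure ν₂] :
    Integrable (fun z : ℝ × ℝ => quadrantDelta μ U V z.1 z.2) (ν₁.prod ν₂) :=
  (integrable_measureReal_quadrant hU hV _).sub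
    ((integrable_measureReal_lt hU ν₁).mul_prod (integrable_measureReal_lt hV ν₂))

theorem integral_ramp (hU : Measurable U) (a b : ℝ) :
    ∫ ω, ramp a b (U ω) ∂μ = ∫ x in Set.Ioc a b, μ.real {ω | x < U ω} := by
  simp_rw [ramp_eq_integral]
  have hs : MeasurableSet {q : Ω × ℝ | q.2 < U q.1} :=
    measurableSet_lt (by fun_prop) (by fun_prop)
  rw [integral_integral_swap]
  · refine integral_congr_ae (ae_of_all _ fun x => ?_)
    have : (fun ω => (Set.Iio (U ω)).indicator (fun _ => (1 : ℝ)) x)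
        = {ω | x < U ω}.indicator fun _ => 1 := by
      ext ω; simp [Set.indicator]
    simp only [this]
    rw [integral_indicator_const _ (measurableSet_lt measurable_const hU), smul_eq_mul, mul_one]
  · have : (Function.uncurry fun (ω : Ω) (x : ℝ) => (Set.Iio (U ω)).indicator
        (fun _ => (1 : ℝ)) x) = {q : Ω × ℝ | q.2 < U q.1}.indicator fun _ => 1 := by
      ext q; simp [Set.indicator, Function.uncurry]
    rw [this]
    exact (integrable_const _).indicator hs

theorem integral_ramp_mul_ramp (hU : Measurable U) (hV : Measurable V) (a b c d : ℝ) :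
    ∫ ω, ramp a b (U ω) * ramp c d (V ω) ∂μ =
      ∫ z, μ.real {ω | z.1 < U ω ∧ z.2 < V ω}
        ∂((volume.restrict (Set.Ioc a b)).prod (volume.restrict (Set.Ioc c d))) := by
  simp_rw [ramp_eq_integral, ← integral_prod_mul]
  have hs : MeasurableSet {q : Ω × (ℝ × ℝ) | q.2.1 < U q.1 ∧ q.2.2 < V q.1} := by
    rw [Set.ofPred_and]
    exact (measurableSet_lt (by fun_prop) (by fun_prop)).inter
      (measurableSet_lt (by fun_prop) (by fun_prop))
  have key : ∀ (ω : Ω) (z : ℝ × ℝ), (Set.Iio (U ω)).indicator (fun _ => (1 : ℝ)) z.1 *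
      (Set.Iio (V ω)).indicator (fun _ => (1 : ℝ)) z.2 =
      {q : Ω × (ℝ × ℝ) | q.2.1 < U q.1 ∧ q.2.2 < V q.1}.indicator (fun _ => 1) (ω, z) := by
    intro ω z
    by_cases h₁ : z.1 < U ω <;> by_cases h₂ : z.2 < V ω <;> simp [Set.indicator, h₁, h₂]
  simp_rw [key]
  rw [integral_integral_swap]
  · refine integral_congr_ae (ae_of_all _ fun z => ?_)
    have : (fun ω => {q : Ω × (ℝ × ℝ) | q.2.1 < U q.1 ∧ q.2.2 < V q.1}.indicator
        (fun _ => (1 : ℝ)) (ω, z)) = {ω | z.1 < U ω ∧ z.2 < V ω}.indicator fun _ => 1 := by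
      ext ω; simp [Set.indicator]
    simp only [this]
    have hz : MeasurableSet {ω | z.1 < U ω ∧ z.2 < V ω} := by
      rw [Set.ofPred_and]
      exact (measurableSet_lt measurable_const hU).inter (measurableSet_lt measurable_const hV)
    rw [integral_indicator_const _ hz, smul_eq_mul, mul_one]
  · exact (integrable_const _).indicator hs

/-- **Hoeffding's covariance identity** for ramps. -/
theorem covariance_ramp (hU : Measurable U) (hV : Measurable V) {a b c d : ℝ}
    (hab : a ≤ b) (hcd : c ≤ d) :
    cov[fun ω => ramp a b (U ω), fun ω => ramp c d (V ω); μ] =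
      ∫ z in Set.Ioc a b ×ˢ Set.Ioc c d, quadrantDelta μ U V z.1 z.2 := by
  rw [covariance_eq_sub (memLp_ramp hab hU 2) (memLp_ramp hcd hV 2)]
  simp only [Pi.mul_apply]
  rw [integral_ramp_mul_ramp hU hV, integral_ramp hU, integral_ramp hV, ← integral_prod_mul,
    ← integral_sub (integrable_measureReal_quadrant hU hV _)
      ((integrable_measureReal_lt hU _).mul_prod (integrable_measureReal_lt hV _)),
    Measure.volume_eq_prod, ← Measure.prod_restrict]
  rfl

theorem quadrantG_eq_setIntegral (hU : Measurable U) (hV : Measurable V) {u v : ℝ}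
    (hu : 0 ≤ u) (hv : 0 ≤ v) :
    quadrantG μ U V u v =
      ∫ z in Set.Ioc (-u) u ×ˢ Set.Ioc (-v) v, quadrantDelta μ U V z.1 z.2 := by
  rw [Measure.volume_eq_prod, ← Measure.prod_restrict,
    integral_prod_symm _ (integrable_quadrantDelta hU hV _ _), quadrantG,
    intervalIntegral.integral_of_le (by linarith)]
  refine integral_congr_ae (ae_of_all _ fun y => ?_)
  simp only
  rw [intervalIntegral.integral_of_le (by linarith)]

/-- Passing to complements in both coordinates leaves the dependence deficit unchanged. -/
theorem quadrantDelta_eq (hU : Measurable U) (hV : Measurable V) (x y : ℝ) :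
    quadrantDelta μ U V x y =
      μ.real {ω | U ω ≤ x ∧ V ω ≤ y} - μ.real {ω | U ω ≤ x} * μ.real {ω | V ω ≤ y} := by
  have mU : MeasurableSet {ω | U ω ≤ x} := measurableSet_le hU measurable_const
  have mV : MeasurableSet {ω | V ω ≤ y} := measurableSet_le hV measurable_const
  have h1 : {ω | x < U ω} = {ω | U ω ≤ x}ᶜ := by ext; simp
  have h2 : {ω | y < V ω} = {ω | V ω ≤ y}ᶜ := by ext; simp
  have h3 : {ω | x < U ω ∧ y < V ω} = ({ω | U ω ≤ x} ∪ {ω | V ω ≤ y})ᶜ := by ext; simp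
  have h4 : {ω | U ω ≤ x ∧ V ω ≤ y} = {ω | U ω ≤ x} ∩ {ω | V ω ≤ y} := rfl
  have h5 := measureReal_union_add_inter (μ := μ) (s := {ω | U ω ≤ x}) mV
  rw [quadrantDelta, h1, h2, h3, h4, probReal_compl_eq_one_sub mU, probReal_compl_eq_one_sub mV,
    probReal_compl_eq_one_sub (mU.union mV)]
  linarith

theorem covariance_ramp_nonneg (hU : Measurable U) (hV : Measurable V)
    (hΔ : ∀ x y, 0 ≤ quadrantDelta μ U V x y) {a b c d : ℝ} (hab : a ≤ b) (hcd : c ≤ d) :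
    0 ≤ cov[fun ω => ramp a b (U ω), fun ω => ramp c d (V ω); μ] := by
  rw [covariance_ramp hU hV hab hcd]
  exact integral_nonneg fun z => hΔ _ _

theorem covariance_ramp_le_quadrantG (hU : Measurable U) (hV : Measurable V)
    (hΔ : ∀ x y, 0 ≤ quadrantDelta μ U V x y) {a b c d u v : ℝ} (hab : a ≤ b) (hcd : c ≤ d)
    (ha : -u ≤ a) (hb : b ≤ u) (hc : -v ≤ c) (hd : d ≤ v) :
    cov[fun ω => ramp a b (U ω), fun ω => ramp c d (V ω); μ] ≤ quadrantG μ U V u v := by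
  rw [covariance_ramp hU hV hab hcd,
    quadrantG_eq_setIntegral hU hV (by linarith) (by linarith)]
  refine setIntegral_mono_set ?_ (ae_of_all _ fun z => hΔ _ _)
    (Set.prod_mono (Set.Ioc_subset_Ioc ha hb) (Set.Ioc_subset_Ioc hc hd)).eventuallyLE
  have := integrable_quadrantDelta (μ := μ) hU hV (volume.restrict (Set.Ioc (-u) u))
    (volume.restrict (Set.Ioc (-v) v))
  rwa [Measure.prod_restrict, ← Measure.volume_eq_prod] at this

end Hoeffding

/-! ### Sums of squares along geometric subsequences -/

theorem sum_sum_Icc_of_symm (f : ℕ → ℕ → ℝ) (hf : ∀ i j, f i j = f j i) (n : ℕ) :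
    ∑ i ∈ Finset.Icc 1 n, ∑ j ∈ Finset.Icc 1 n, f i j =
      ∑ j ∈ Finset.Icc 1 n, (f j j + 2 * ∑ k ∈ Finset.Ico 1 j, f k j) := by
  induction n with
  | zero => simp
  | succ n ih =>
    have h : ∑ k ∈ Finset.Ico 1 (n + 1), f k (n + 1) = ∑ k ∈ Finset.Icc 1 n, f k (n + 1) := rfl
    simp_rw [Finset.sum_Icc_succ_top (Nat.le_add_left 1 n), Finset.sum_add_distrib, h] at *
    rw [ih, Finset.sum_congr rfl fun j _ => hf (n + 1) j]
    ring

/-- Each `d j` occurs in the `i`-th sum only when `j ≤ ⌊c ^ i⌋`, and `∑ 1 / ⌊c ^ i⌋ ^ 2` over these `i`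
is of order `1 / j ^ 2`. -/
theorem sum_div_floor_pow_sq_le {c : ℝ} (hc : 1 < c) {d : ℕ → ℝ} (hd : ∀ j, 1 ≤ j → 0 ≤ d j)
    {C : ℝ} (hC : ∀ n : ℕ, ∑ j ∈ Finset.Icc 1 n, d j / (j : ℝ) ^ 2 ≤ C) (N : ℕ) :
    ∑ i ∈ Finset.range N, (∑ j ∈ Finset.Icc 1 ⌊c ^ i⌋₊, d j) / (⌊c ^ i⌋₊ : ℝ) ^ 2 ≤
      4 * (c ^ 5 * (c - 1)⁻¹ ^ 3) * C := by
  have hK : 0 ≤ c ^ 5 * (c - 1)⁻¹ ^ 3 := by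
    have : 0 < c - 1 := by linarith
    positivity
  have step : ∀ i ∈ Finset.range N,
      (∑ j ∈ Finset.Icc 1 ⌊c ^ i⌋₊, d j) / (⌊c ^ i⌋₊ : ℝ) ^ 2 =
        ∑ j ∈ Finset.Icc 1 ⌊c ^ N⌋₊, d j * if j ≤ ⌊c ^ i⌋₊ then 1 / (⌊c ^ i⌋₊ : ℝ) ^ 2 else 0 := by
    intro i hi
    have hle : ⌊c ^ i⌋₊ ≤ ⌊c ^ N⌋₊ :=
      Nat.floor_le_floor (pow_le_pow_right₀ hc.le (Finset.mem_range.1 hi).le)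
    rw [Finset.sum_div]
    simp_rw [mul_ite, mul_zero]
    rw [← Finset.sum_filter]
    refine Finset.sum_congr ?_ fun j _ => by ring
    ext j
    simp only [Finset.mem_Icc, Finset.mem_filter]
    omega
  rw [Finset.sum_congr rfl step, Finset.sum_comm]
  calc _ ≤ ∑ j ∈ Finset.Icc 1 ⌊c ^ N⌋₊, d j * (4 * (c ^ 5 * (c - 1)⁻¹ ^ 3) / (j : ℝ) ^ 2) := by
        refine Finset.sum_le_sum fun j hj => ?_
        have hj1 : 1 ≤ j := (Finset.mem_Icc.1 hj).1
        have hj0 : (0 : ℝ) < j := by exact_mod_cast hj1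
        rw [← Finset.mul_sum]
        refine mul_le_mul_of_nonneg_left ?_ (hd j hj1)
        rw [← Finset.sum_filter]
        -- The available tail bound is for a strict inequality, hence the threshold `j / 2`.
        have h := sum_div_nat_floor_pow_sq_le_div_sq N (half_pos hj0) hc
        refine (Finset.sum_le_sum_of_subset_of_nonneg (fun i hi => ?_)
          fun _ _ _ => by positivity).trans (h.trans_eq ?_)
        · rw [Finset.mem_filter] at hi ⊢
          refine ⟨hi.1, ?_⟩
          have : (j : ℝ) ≤ ⌊c ^ i⌋₊ := by exact_mod_cast hi.2
          linarith
        · field_simp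
          norm_num
    _ = 4 * (c ^ 5 * (c - 1)⁻¹ ^ 3) * ∑ j ∈ Finset.Icc 1 ⌊c ^ N⌋₊, d j / (j : ℝ) ^ 2 := by
        rw [Finset.mul_sum]
        exact Finset.sum_congr rfl fun j _ => by ring
    _ ≤ _ := mul_le_mul_of_nonneg_left (hC _) (by positivity)

/-! ### Strong law and converse Borel–Cantelli from covariance bounds -/

section StrongLaw

variable {Ω : Type*} [MeasurableSpace Ω] {μ : Measure Ω}

theorem ae_tendsto_zero_of_sum_integral_sq_le {Y : ℕ → Ω → ℝ} (hY : ∀ i, MemLp (Y i) 2 μ)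
    {C : ℝ} (hC : ∀ N, ∑ i ∈ Finset.range N, ∫ ω, Y i ω ^ 2 ∂μ ≤ C) :
    ∀ᵐ ω ∂μ, Tendsto (fun i => Y i ω) atTop (𝓝 0) := by
  have hmeas : ∀ i, AEMeasurable (fun ω => ENNReal.ofReal (Y i ω ^ 2)) μ := fun i =>
    ((hY i).aemeasurable.pow_const 2).ennreal_ofReal
  have hfin : ∫⁻ ω, ∑' i, ENNReal.ofReal (Y i ω ^ 2) ∂μ ≠ ⊤ := by
    rw [lintegral_tsum hmeas]
    refine ne_top_of_le_ne_top (ENNReal.ofReal_ne_top (r := C)) ?_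
    refine ENNReal.tsum_le_of_sum_range_le fun N => ?_
    have : ∀ i, ∫⁻ ω, ENNReal.ofReal (Y i ω ^ 2) ∂μ = ENNReal.ofReal (∫ ω, Y i ω ^ 2 ∂μ) :=
      fun i => (ofReal_integral_eq_lintegral_ofReal (hY i).integrable_sq
        (ae_of_all _ fun ω => sq_nonneg _)).symm
    simp_rw [this]
    rw [← ENNReal.ofReal_sum_of_nonneg fun i _ => integral_nonneg fun ω => sq_nonneg _]
    exact ENNReal.ofReal_le_ofReal (hC N)
  filter_upwards [ae_lt_top' (AEMeasurable.tsum hmeas) hfin] with ω hω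
  have h := ENNReal.tendsto_atTop_zero_of_tsum_ne_top hω.ne
  have h2 : Tendsto (fun i => Y i ω ^ 2) atTop (𝓝 0) := by
    have := (ENNReal.tendsto_toReal ENNReal.zero_ne_top).comp h
    simpa [Function.comp_def, ENNReal.toReal_ofReal (sq_nonneg _)] using this
  have h3 := h2.sqrt
  simp only [Real.sqrt_sq_eq_abs, Real.sqrt_zero] at h3
  exact (tendsto_zero_iff_abs_tendsto_zero _).2 h3

variable [IsProbabilityMeasure μ]

theorem variance_sum_Icc {Z : ℕ → Ω → ℝ} (hZ : ∀ k, 1 ≤ k → MemLp (Z k) 2 μ) (n : ℕ) :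
    Var[fun ω => ∑ k ∈ Finset.Icc 1 n, Z k ω; μ] =
      ∑ j ∈ Finset.Icc 1 n, (Var[Z j; μ] + 2 * ∑ k ∈ Finset.Ico 1 j, cov[Z k, Z j; μ]) := by
  rw [variance_fun_sum' fun i hi => hZ i (Finset.mem_Icc.1 hi).1,
    sum_sum_Icc_of_symm _ fun i j => covariance_comm _ _]
  refine Finset.sum_congr rfl fun j hj => ?_
  rw [covariance_self (hZ j (Finset.mem_Icc.1 hj).1).aemeasurable]

/-- A strong law of large numbers for nonnegative, nonnegatively correlated variables. As in
Etemadi's proof, the averages converge along geometric subsequences because their variances are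
summable there, and nonnegativity of the variables makes the partial sums monotone, which fills the
gaps. -/
theorem strong_law_of_sum_covariance_le {Z : ℕ → Ω → ℝ} (hZ : ∀ k, 1 ≤ k → MemLp (Z k) 2 μ)
    (hnonneg : ∀ k, 1 ≤ k → ∀ ω, 0 ≤ Z k ω)
    (hcov : ∀ k j, 1 ≤ k → k < j → 0 ≤ cov[Z k, Z j; μ])
    {C₁ C₂ : ℝ} (hvar : ∀ n : ℕ, ∑ k ∈ Finset.Icc 1 n, Var[Z k; μ] / (k : ℝ) ^ 2 ≤ C₁)
    (hsum : ∀ n : ℕ, ∑ j ∈ Finset.Icc 1 n, ∑ k ∈ Finset.Ico 1 j,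
      cov[Z k, Z j; μ] / ((k : ℝ) * j) ≤ C₂)
    {m : ℝ} (hmean : Tendsto (fun n : ℕ => (∑ k ∈ Finset.Icc 1 n, ∫ ω, Z k ω ∂μ) / n)
      atTop (𝓝 m)) :
    ∀ᵐ ω ∂μ, Tendsto (fun n : ℕ => (∑ k ∈ Finset.Icc 1 n, Z k ω) / n) atTop (𝓝 m) := by
  set d : ℕ → ℝ := fun j => Var[Z j; μ] + 2 * ∑ k ∈ Finset.Ico 1 j, cov[Z k, Z j; μ] with hd
  have hcov' : ∀ j, 0 ≤ ∑ k ∈ Finset.Ico 1 j, cov[Z k, Z j; μ] := fun j =>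
    Finset.sum_nonneg fun k hk => hcov k j (Finset.mem_Ico.1 hk).1 (Finset.mem_Ico.1 hk).2
  have hd0 : ∀ j, 1 ≤ j → 0 ≤ d j := fun j _ =>
    add_nonneg (variance_nonneg _ _) (mul_nonneg zero_le_two (hcov' j))
  have hdC : ∀ n : ℕ, ∑ j ∈ Finset.Icc 1 n, d j / (j : ℝ) ^ 2 ≤ C₁ + 2 * C₂ := by
    intro n
    refine le_trans ?_ (add_le_add (hvar n) (mul_le_mul_of_nonneg_left (hsum n) zero_le_two))
    rw [Finset.mul_sum, ← Finset.sum_add_distrib]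
    refine Finset.sum_le_sum fun j hj => ?_
    rw [hd, add_div, mul_div_assoc, Finset.sum_div]
    gcongr with k hk
    · obtain ⟨h1, h2⟩ := Finset.mem_Ico.1 hk
      exact hcov k j h1 h2
    · have : (0 : ℝ) < k := by exact_mod_cast (Finset.mem_Ico.1 hk).1
      have : (0 : ℝ) < j := by exact_mod_cast (Finset.mem_Icc.1 hj).1
      positivity
    · have : (k : ℝ) ≤ j := by exact_mod_cast (Finset.mem_Ico.1 hk).2.le
      rw [sq]
      gcongr
  have hS : ∀ n : ℕ, MemLp (fun ω => ∑ k ∈ Finset.Icc 1 n, Z k ω) 2 μ := fun n =>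
    memLp_finsetSum _ fun i hi => hZ i (Finset.mem_Icc.1 hi).1
  have hES : ∀ n : ℕ, ∫ ω, ∑ k ∈ Finset.Icc 1 n, Z k ω ∂μ = ∑ k ∈ Finset.Icc 1 n, ∫ ω, Z k ω ∂μ :=
    fun n => integral_finsetSum _ fun i hi => (hZ i (Finset.mem_Icc.1 hi).1).integrable one_le_two
  -- Along a geometric subsequence the variances of the averages are summable.
  have hsub : ∀ c : ℝ, 1 < c → ∀ᵐ ω ∂μ, Tendsto (fun i : ℕ =>
      (∑ k ∈ Finset.Icc 1 ⌊c ^ i⌋₊, Z k ω) / (⌊c ^ i⌋₊ : ℝ)) atTop (𝓝 m) := by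
    intro c hc
    have hlim : Tendsto (fun i : ℕ => ⌊c ^ i⌋₊) atTop atTop :=
      tendsto_nat_floor_atTop.comp (tendsto_pow_atTop_atTop_of_one_lt hc)
    have key := ae_tendsto_zero_of_sum_integral_sq_le (μ := μ)
      (Y := fun i ω => (∑ k ∈ Finset.Icc 1 ⌊c ^ i⌋₊, Z k ω -
        ∫ ω, ∑ k ∈ Finset.Icc 1 ⌊c ^ i⌋₊, Z k ω ∂μ) * (⌊c ^ i⌋₊ : ℝ)⁻¹)
      (fun i => ((hS _).sub (memLp_const _)).mul_const _)
      (C := 4 * (c ^ 5 * (c - 1)⁻¹ ^ 3) * (C₁ + 2 * C₂)) (fun N => by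
        refine le_trans (le_of_eq ?_) (sum_div_floor_pow_sq_le hc hd0 hdC N)
        refine Finset.sum_congr rfl fun i _ => ?_
        simp_rw [mul_pow]
        rw [integral_mul_const, ← variance_eq_integral (hS _).aemeasurable,
          variance_sum_Icc hZ, inv_pow, div_eq_mul_inv])
    filter_upwards [key] with ω hω
    have h := hω.add (hmean.comp hlim)
    rw [zero_add] at h
    refine h.congr fun i => ?_
    simp only [Function.comp, hES]
    ring
  obtain ⟨c, -, hc1, hclim⟩ := exists_seq_strictAnti_tendsto (1 : ℝ)
  filter_upwards [ae_all_iff.2 fun k => hsub (c k) (hc1 k)] with ω hω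
  refine tendsto_div_of_monotone_of_tendsto_div_floor_pow
    (fun n => ∑ k ∈ Finset.Icc 1 n, Z k ω) m ?_ c hc1 hclim hω
  refine monotone_nat_of_le_succ fun n => ?_
  rw [Finset.sum_Icc_succ_top (Nat.le_add_left 1 n)]
  exact le_add_of_nonneg_right (hnonneg _ (Nat.le_add_left 1 n) ω)

/-- A converse Borel–Cantelli lemma for `[0, 1]`-valued variables: bounded total covariance makes the
variance of the partial sums at most linear in their mean, so by Chebyshev's inequality divergence
of the means forces divergence of the sums. -/
theorem exists_sum_integral_le_of_ae_eventually_eq_zero {W : ℕ → Ω → ℝ}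
    (hmeas : ∀ k, 1 ≤ k → Measurable (W k)) (h0 : ∀ k, 1 ≤ k → ∀ ω, 0 ≤ W k ω)
    (h1 : ∀ k, 1 ≤ k → ∀ ω, W k ω ≤ 1)
    {C : ℝ} (hsum : ∀ n : ℕ, ∑ j ∈ Finset.Icc 1 n, ∑ k ∈ Finset.Ico 1 j, cov[W k, W j; μ] ≤ C)
    (hev : ∀ᵐ ω ∂μ, ∀ᶠ k in atTop, W k ω = 0) :
    ∃ K, ∀ n : ℕ, ∑ k ∈ Finset.Icc 1 n, ∫ ω, W k ω ∂μ ≤ K := by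
  have hW : ∀ k, 1 ≤ k → MemLp (W k) 2 μ := fun k hk =>
    MemLp.of_bound (hmeas k hk).aestronglyMeasurable 1 (ae_of_all _ fun ω => by
      rw [Real.norm_of_nonneg (h0 k hk ω)]; exact h1 k hk ω)
  set S : ℕ → Ω → ℝ := fun n ω => ∑ k ∈ Finset.Icc 1 n, W k ω with hSdef
  set e : ℕ → ℝ := fun n => ∑ k ∈ Finset.Icc 1 n, ∫ ω, W k ω ∂μ with he
  have hS : ∀ n : ℕ, MemLp (S n) 2 μ := fun n =>
    memLp_finsetSum _ fun i hi => hW i (Finset.mem_Icc.1 hi).1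
  have hES : ∀ n : ℕ, ∫ ω, S n ω ∂μ = e n :=
    fun n => integral_finsetSum _ fun i hi => (hW i (Finset.mem_Icc.1 hi).1).integrable one_le_two
  have hSm : ∀ n, Measurable (S n) := fun n =>
    Finset.measurable_fun_sum _ fun i hi => hmeas i (Finset.mem_Icc.1 hi).1
  have hmono : ∀ ω, Monotone fun n => S n ω := fun ω => monotone_nat_of_le_succ fun n => by
    simp only [hSdef, Finset.sum_Icc_succ_top (Nat.le_add_left 1 n)]
    exact le_add_of_nonneg_right (h0 _ (Nat.le_add_left 1 n) ω)
  have hemono : Monotone e := monotone_nat_of_le_succ fun n => by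
    simp only [he, Finset.sum_Icc_succ_top (Nat.le_add_left 1 n)]
    exact le_add_of_nonneg_right (integral_nonneg fun ω => h0 _ (Nat.le_add_left 1 n) ω)
  have hvar : ∀ n, Var[S n; μ] ≤ e n + 2 * C := by
    intro n
    rw [hSdef, variance_sum_Icc hW, Finset.sum_add_distrib, ← Finset.mul_sum]
    refine add_le_add (Finset.sum_le_sum fun k hk => ?_)
      (mul_le_mul_of_nonneg_left (hsum n) zero_le_two)
    have hk1 := (Finset.mem_Icc.1 hk).1
    refine (variance_le_expectation_sq (hW k hk1).1).trans
      (integral_mono (hW k hk1).integrable_sq ((hW k hk1).integrable one_le_two) fun ω => ?_)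
    have := h0 k hk1 ω
    have := h1 k hk1 ω
    simp only [Pi.pow_apply]
    nlinarith
  have hbdd : ∀ᵐ ω ∂μ, ∃ M : ℕ, ∀ n, S n ω ≤ M := by
    filter_upwards [hev] with ω hω
    obtain ⟨N, hN⟩ := eventually_atTop.1 hω
    obtain ⟨M, hM⟩ := exists_nat_ge (S N ω)
    have hconst : ∀ n, N ≤ n → S n ω = S N ω := fun n hn => by
      induction n, hn using Nat.le_induction with
      | base => rfl
      | succ n hn ih =>
        simp only [hSdef] at ih ⊢
        rw [Finset.sum_Icc_succ_top (Nat.le_add_left 1 n), ih, hN _ (by omega), add_zero]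
    refine ⟨M, fun n => le_trans ?_ hM⟩
    rcases le_total n N with h | h
    · exact hmono ω h
    · exact (hconst n h).le
  by_contra! hunb
  have hetop : Tendsto e atTop atTop := tendsto_atTop_atTop_of_monotone hemono fun b =>
    let ⟨n, hn⟩ := hunb b
    ⟨n, hn.le⟩
  -- Chebyshev: if the means diverge, the partial sums exceed any level in probability.
  have hnull : ∀ M : ℕ, μ {ω | ∀ n, S n ω ≤ M} = 0 := by
    intro M
    have hlim : Tendsto (fun n => ENNReal.ofReal (8 / e n)) atTop (𝓝 0) := by
      simpa using ENNReal.tendsto_ofReal (hetop.const_div_atTop 8)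
    refine le_antisymm (ge_of_tendsto hlim ?_) zero_le
    filter_upwards [hetop.eventually_ge_atTop (2 * M + 1), hetop.eventually_ge_atTop (2 * C)]
      with n hn hnC
    have hM0 : (0 : ℝ) ≤ M := M.cast_nonneg
    have he0 : 0 < e n := by linarith
    have hcheb := meas_ge_le_variance_div_sq (hS n) (half_pos he0)
    refine (measure_mono fun ω hω => ?_).trans (hcheb.trans (ENNReal.ofReal_le_ofReal ?_))
    · have hω' : S n ω ≤ M := hω n
      change e n / 2 ≤ |S n ω - ∫ ω, S n ω ∂μ|
      rw [hES, abs_sub_comm]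
      exact le_trans (by linarith) (le_abs_self _)
    · rw [div_le_div_iff₀ (by positivity) he0]
      have := hvar n
      nlinarith
  have hzero : μ (⋃ M : ℕ, {ω | ∀ n, S n ω ≤ M}) = 0 := measure_iUnion_null hnull
  have hnot : ∀ᵐ ω ∂μ, ω ∉ ⋃ M : ℕ, {ω | ∀ n, S n ω ≤ M} := measure_eq_zero_iff_ae_notMem.1 hzero
  obtain ⟨ω, ⟨M, hM⟩, h⟩ := (hbdd.and hnot).exists
  exact h (Set.mem_iUnion.2 ⟨M, hM⟩)

end StrongLaw

/-! ### Ramps and averages of real sequences -/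

theorem ramp_neg {a b : ℝ} (hab : a ≤ b) (t : ℝ) :
    ramp a b (-t) = (b - a) - ramp (-b) (-a) t := by
  unfold ramp
  rcases le_total t (-b) with h | h
  · rw [min_eq_right (by linarith : b ≤ -t), min_eq_left (by linarith : t ≤ -a),
      max_eq_left (by linarith), max_eq_right (by linarith)]
    ring
  rcases le_total t (-a) with h' | h'
  · rw [min_eq_left (by linarith : -t ≤ b), min_eq_left h', max_eq_left (by linarith),
      max_eq_left (by linarith)]
    ring
  · rw [min_eq_left (by linarith : -t ≤ b), min_eq_right h', max_eq_right (by linarith),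
      max_eq_left (by linarith)]
    ring

theorem ramp_zero_left {k : ℝ} (hk : 0 ≤ k) (t : ℝ) : ramp 0 k t = min (max t 0) k := by
  unfold ramp
  rw [sub_zero, max_comm, max_comm t, max_min_distrib_left, max_eq_right hk]

theorem sum_ramp_sq_div_sq_le (t : ℝ) (n : ℕ) :
    ∑ k ∈ Finset.Icc 1 n, ramp 0 k t ^ 2 / (k : ℝ) ^ 2 ≤ 3 * max t 0 := by
  set y := max t 0 with hy
  have hy0 : 0 ≤ y := le_max_right _ _
  have hr : ∀ k : ℕ, ramp 0 k t = min y k := fun k => ramp_zero_left k.cast_nonneg t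
  have hmin : ∀ k : ℕ, 0 ≤ min y k := fun k => le_min hy0 k.cast_nonneg
  simp_rw [hr]
  have hsub : Finset.Icc 1 n ⊆ Finset.Icc 1 ⌊y⌋₊ ∪ Finset.Ioo ⌊y⌋₊ (n + 1) := by
    intro k
    simp only [Finset.mem_union, Finset.mem_Icc, Finset.mem_Ioo]
    omega
  have hdisj : Disjoint (Finset.Icc 1 ⌊y⌋₊) (Finset.Ioo ⌊y⌋₊ (n + 1)) := by
    rw [Finset.disjoint_left]
    intro k
    simp only [Finset.mem_Icc, Finset.mem_Ioo]
    omega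
  refine (Finset.sum_le_sum_of_subset_of_nonneg hsub fun k _ _ => by positivity).trans ?_
  rw [Finset.sum_union hdisj]
  have h1 : ∑ k ∈ Finset.Icc 1 ⌊y⌋₊, min y k ^ 2 / (k : ℝ) ^ 2 ≤ y := by
    calc _ ≤ ∑ k ∈ Finset.Icc 1 ⌊y⌋₊, (1 : ℝ) := by
          refine Finset.sum_le_sum fun k _ => div_le_one_of_le₀ ?_ (by positivity)
          exact pow_le_pow_left₀ (hmin k) (min_le_right _ _) 2
      _ = ⌊y⌋₊ := by simp
      _ ≤ y := Nat.floor_le hy0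
  have h2 : ∑ k ∈ Finset.Ioo ⌊y⌋₊ (n + 1), min y k ^ 2 / (k : ℝ) ^ 2 ≤ 2 * y := by
    calc _ ≤ ∑ k ∈ Finset.Ioo ⌊y⌋₊ (n + 1), y ^ 2 * ((k : ℝ) ^ 2)⁻¹ := by
          refine Finset.sum_le_sum fun k _ => ?_
          rw [div_eq_mul_inv]
          exact mul_le_mul_of_nonneg_right
            (pow_le_pow_left₀ (hmin k) (min_le_left _ _) 2) (by positivity)
      _ ≤ y ^ 2 * (2 / ((⌊y⌋₊ : ℝ) + 1)) := by
          rw [← Finset.mul_sum]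
          exact mul_le_mul_of_nonneg_left (sum_Ioo_inv_sq_le _ _) (by positivity)
      _ ≤ 2 * y := by
          have : y < (⌊y⌋₊ : ℝ) + 1 := Nat.lt_floor_add_one y
          rw [mul_div_assoc', div_le_iff₀ (by positivity)]
          nlinarith
  linarith

/-- The normalized ramp of index `k` equals `1` on `[k, ∞)`, so the normalized ramps sum to at least
the number of `k ≤ n` lying below `t`. -/
theorem min_max_le_sum_ramp_div (t : ℝ) (n : ℕ) :
    min (max t 0) (n + 1) ≤ 1 + ∑ k ∈ Finset.Icc 1 n, ramp (k / 2) k t / (k / 2) := by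
  induction n with
  | zero => simp
  | succ n ih =>
    rw [Finset.sum_Icc_succ_top (Nat.le_add_left 1 n)]
    have hn : (0 : ℝ) ≤ n := n.cast_nonneg
    push_cast
    have hnn : 0 ≤ ramp (((n : ℝ) + 1) / 2) (n + 1) t / (((n : ℝ) + 1) / 2) :=
      div_nonneg (ramp_nonneg _ _ _) (by positivity)
    rcases le_or_gt t (n + 1) with h | h
    · have h' : max t 0 ≤ n + 1 := max_le h (by positivity)
      rw [min_eq_left h'] at ih
      linarith [min_le_left (max t 0) ((n : ℝ) + 1 + 1)]
    · have h1 : ramp (((n : ℝ) + 1) / 2) (n + 1) t / (((n : ℝ) + 1) / 2) = 1 := by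
        unfold ramp
        rw [min_eq_right h.le, max_eq_left (by linarith)]
        field_simp
        norm_num
      rw [min_eq_right (h.le.trans (le_max_left _ _))] at ih
      rw [h1]
      linarith [min_le_right (max t 0) ((n : ℝ) + 1 + 1)]

theorem tendsto_sum_Icc_div {u : ℕ → ℝ} {l : ℝ} (hu : Tendsto u atTop (𝓝 l)) :
    Tendsto (fun n : ℕ => (∑ k ∈ Finset.Icc 1 n, u k) / n) atTop (𝓝 l) := by
  refine (((tendsto_add_atTop_iff_nat 1).2 hu).cesaro).congr fun n => ?_
  rw [div_eq_inv_mul, Finset.range_eq_Ico, Finset.sum_Ico_add']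
  rfl

theorem tendsto_div_of_tendsto_sum_Icc_div {u : ℕ → ℝ} {c : ℝ}
    (h : Tendsto (fun n : ℕ => (∑ k ∈ Finset.Icc 1 n, (u k - c)) / n) atTop (𝓝 0)) :
    Tendsto (fun n : ℕ => u n / n) atTop (𝓝 0) := by
  rw [← tendsto_add_atTop_iff_nat 1]
  have h1 := (tendsto_add_atTop_iff_nat 1).2 h
  have h2 := h.mul (tendsto_natCast_div_add_atTop (1 : ℝ))
  have h3 := (tendsto_add_atTop_iff_nat 1).2 (tendsto_const_div_atTop_nhds_zero_nat c)
  have h4 := (h1.sub h2).add h3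
  simp only [zero_mul, sub_zero, add_zero] at h4
  refine h4.congr fun n => ?_
  rw [Finset.sum_Icc_succ_top (Nat.le_add_left 1 n)]
  rcases Nat.eq_zero_or_pos n with rfl | hn
  · simp
  · have : (0 : ℝ) < n := by exact_mod_cast hn
    push_cast
    field_simp
    ring

theorem exists_sum_le_of_summable {f : ℕ → ℕ → ℝ} (hf : ∀ k j, 1 ≤ k → k < j → 0 ≤ f k j)
    (hsum : Summable fun p : {p : ℕ × ℕ // 1 ≤ p.1 ∧ p.1 < p.2} => f p.1.1 p.1.2) :
    ∃ C, ∀ n : ℕ, ∑ j ∈ Finset.Icc 1 n, ∑ k ∈ Finset.Ico 1 j, f k j ≤ C := by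
  classical
  set s : Set (ℕ × ℕ) := {p | 1 ≤ p.1 ∧ p.1 < p.2}
  have hind : Summable (s.indicator fun p => f p.1 p.2) := summable_subtype_iff_indicator.1 hsum
  refine ⟨∑' p, s.indicator (fun p => f p.1 p.2) p, fun n => ?_⟩
  refine le_trans (le_of_eq ?_) (hind.sum_le_tsum (Finset.Icc 1 n ×ˢ Finset.Icc 1 n)
    fun p _ => Set.indicator_nonneg (fun p hp => hf _ _ hp.1 hp.2) p)
  rw [Finset.sum_product_right]
  refine Finset.sum_congr rfl fun j hj => ?_
  simp only [Set.indicator_apply]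
  rw [← Finset.sum_filter]
  refine Finset.sum_congr ?_ fun _ _ => rfl
  ext k
  have := Finset.mem_Icc.1 hj
  simp only [Finset.mem_Ico, Finset.mem_filter, Finset.mem_Icc, s, Set.mem_ofPred_eq]
  omega

/-! ### The two directions for positive parts -/

section Ramps

variable {Ω : Type*} [MeasurableSpace Ω] {μ : Measure Ω} [IsProbabilityMeasure μ]

theorem covariance_ramp_neg {U V : Ω → ℝ} (hU : Measurable U) (hV : Measurable V) {a b c d : ℝ}
    (hab : a ≤ b) (hcd : c ≤ d) :
    cov[fun ω => ramp a b (-U ω), fun ω => ramp c d (-V ω); μ] =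
      cov[fun ω => ramp (-b) (-a) (U ω), fun ω => ramp (-d) (-c) (V ω); μ] := by
  simp_rw [ramp_neg hab, ramp_neg hcd]
  rw [covariance_const_sub_left ((memLp_ramp (neg_le_neg hab) hU 1).integrable le_rfl),
    covariance_const_sub_right ((memLp_ramp (neg_le_neg hcd) hV 1).integrable le_rfl), neg_neg]

theorem ae_eventually_le_natCast {Y : ℕ → Ω → ℝ}
    (hident : ∀ k : ℕ, 1 ≤ k → IdentDistrib (Y k) (Y 1) μ μ) (hint : Integrable (Y 1) μ) :
    ∀ᵐ ω ∂μ, ∀ᶠ k : ℕ in atTop, Y k ω ≤ k := by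
  have hfin : ∑' k : ℕ, μ {ω | |Y 1 ω| ∈ Set.Ioi (k : ℝ)} < ⊤ :=
    letI : MeasureSpace Ω := ⟨μ⟩
    tsum_prob_mem_Ioi_lt_top (X := fun ω => |Y 1 ω|) hint.abs fun ω => abs_nonneg _
  have hle : ∀ k : ℕ, μ {ω | ((k + 1 : ℕ) : ℝ) < Y (k + 1) ω} ≤
      μ {ω | |Y 1 ω| ∈ Set.Ioi (k : ℝ)} := by
    intro k
    have := (hident (k + 1) (Nat.le_add_left 1 k)).measure_mem_eq
      (measurableSet_Ioi (a := ((k + 1 : ℕ) : ℝ)))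
    refine le_trans (le_of_eq this) (measure_mono fun ω hω => ?_)
    have hω' : ((k + 1 : ℕ) : ℝ) < Y 1 ω := hω
    push_cast at hω'
    change (k : ℝ) < |Y 1 ω|
    linarith [le_abs_self (Y 1 ω)]
  filter_upwards [ae_eventually_notMem (ne_top_of_le_ne_top hfin.ne (ENNReal.tsum_le_tsum hle))]
    with ω hω
  obtain ⟨N, hN⟩ := eventually_atTop.1 hω
  refine eventually_atTop.2 ⟨N + 1, fun k hk => ?_⟩
  obtain ⟨i, rfl⟩ : ∃ i, k = i + 1 := ⟨k - 1, by omega⟩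
  exact not_lt.1 (hN i (by omega))

/-- The strong law for the positive parts, deduced from the one for the truncations
`ramp 0 k (Y k) = min (Y k)⁺ k`. -/
theorem strong_law_positive_part {Y : ℕ → Ω → ℝ} (hmeas : ∀ k, 1 ≤ k → Measurable (Y k))
    (hident : ∀ k : ℕ, 1 ≤ k → IdentDistrib (Y k) (Y 1) μ μ) (hint : Integrable (Y 1) μ)
    (hcov : ∀ k j : ℕ, 1 ≤ k → k < j →
      0 ≤ cov[fun ω => ramp 0 k (Y k ω), fun ω => ramp 0 j (Y j ω); μ])
    {C : ℝ} (hsum : ∀ n : ℕ, ∑ j ∈ Finset.Icc 1 n, ∑ k ∈ Finset.Ico 1 j,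
      cov[fun ω => ramp 0 k (Y k ω), fun ω => ramp 0 j (Y j ω); μ] / ((k : ℝ) * j) ≤ C) :
    ∀ᵐ ω ∂μ, Tendsto (fun n : ℕ => (∑ k ∈ Finset.Icc 1 n, max (Y k ω) 0) / n) atTop
      (𝓝 (∫ ω, max (Y 1 ω) 0 ∂μ)) := by
  have hpos : Integrable (fun ω => max (Y 1 ω) 0) μ := hint.pos_part
  have hmean : Tendsto (fun k : ℕ => ∫ ω, ramp 0 k (Y 1 ω) ∂μ) atTop
      (𝓝 (∫ ω, max (Y 1 ω) 0 ∂μ)) := by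
    refine tendsto_integral_of_dominated_convergence (fun ω => max (Y 1 ω) 0)
      (fun k => ((measurable_ramp 0 k).comp (hmeas 1 le_rfl)).aestronglyMeasurable) hpos
      (fun k => ae_of_all _ fun ω => ?_) (ae_of_all _ fun ω => ?_)
    · rw [Real.norm_of_nonneg (ramp_nonneg _ _ _), ramp_zero_left k.cast_nonneg]
      exact min_le_left _ _
    · refine tendsto_const_nhds.congr' ?_
      filter_upwards [tendsto_natCast_atTop_atTop.eventually_ge_atTop (max (Y 1 ω) 0)] with k hk
      rw [ramp_zero_left k.cast_nonneg, min_eq_left hk]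
  have hvar : ∀ n : ℕ, ∑ k ∈ Finset.Icc 1 n, Var[fun ω => ramp 0 k (Y k ω); μ] / (k : ℝ) ^ 2 ≤
      3 * ∫ ω, max (Y 1 ω) 0 ∂μ := by
    intro n
    have hL : ∀ k : ℕ, MemLp (fun ω => ramp 0 k (Y 1 ω)) 2 μ := fun k =>
      memLp_ramp k.cast_nonneg (hmeas 1 le_rfl) 2
    calc _ ≤ ∑ k ∈ Finset.Icc 1 n, ∫ ω, ramp 0 k (Y 1 ω) ^ 2 / (k : ℝ) ^ 2 ∂μ := by
          refine Finset.sum_le_sum fun k hk => ?_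
          have hk1 := (Finset.mem_Icc.1 hk).1
          rw [integral_div]
          refine div_le_div_of_nonneg_right ?_ (by positivity)
          have hvar_eq := ((hident k hk1).comp (measurable_ramp 0 k)).variance_eq
          exact hvar_eq.trans_le (variance_le_expectation_sq (hL k).1)
      _ = ∫ ω, ∑ k ∈ Finset.Icc 1 n, ramp 0 k (Y 1 ω) ^ 2 / (k : ℝ) ^ 2 ∂μ :=
          (integral_finsetSum _ fun k _ => (hL k).integrable_sq.div_const _).symm
      _ ≤ ∫ ω, 3 * max (Y 1 ω) 0 ∂μ :=
          integral_mono (integrable_finsetSum _ fun k _ => (hL k).integrable_sq.div_const _)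
            (hpos.const_mul 3) fun ω => sum_ramp_sq_div_sq_le _ n
      _ = _ := integral_const_mul _ _
  have hmean' : Tendsto (fun n : ℕ => (∑ k ∈ Finset.Icc 1 n, ∫ ω, ramp 0 k (Y k ω) ∂μ) / n)
      atTop (𝓝 (∫ ω, max (Y 1 ω) 0 ∂μ)) := by
    refine (tendsto_sum_Icc_div hmean).congr fun n => ?_
    congr 1
    exact Finset.sum_congr rfl fun k hk =>
      (((hident k (Finset.mem_Icc.1 hk).1).comp (measurable_ramp 0 k)).integral_eq).symm
  have hslln := strong_law_of_sum_covariance_le (Z := fun k ω => ramp 0 k (Y k ω))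
    (fun k hk => memLp_ramp k.cast_nonneg (hmeas k hk) 2) (fun k _ ω => ramp_nonneg _ _ _)
    hcov hvar hsum hmean'
  -- Truncation at level `k` is eventually inactive.
  filter_upwards [hslln, ae_eventually_le_natCast hident hint] with ω h1 h2
  have h3 : Tendsto (fun k : ℕ => max (Y k ω) 0 - ramp 0 k (Y k ω)) atTop (𝓝 0) := by
    refine tendsto_const_nhds.congr' ?_
    filter_upwards [h2] with k hk
    rw [ramp_zero_left k.cast_nonneg, min_eq_left (max_le hk k.cast_nonneg), sub_self]
  have h4 := h1.add (tendsto_sum_Icc_div h3)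
  rw [add_zero] at h4
  refine h4.congr fun n => ?_
  rw [Finset.sum_sub_distrib]
  ring

/-- If `Y k / k → 0` almost surely, then the normalized ramps `ramp (k / 2) k (Y k) / (k / 2)` vanish
eventually, so their expectations are summable; these dominate `P(Y 1 > k)`. Using ramps instead of
the indicators of `{Y k > k}` is what brings the covariances within reach of an assumption that
involves only integrals of the quadrant dependence, not its values at points. -/
theorem integrable_positive_part {Y : ℕ → Ω → ℝ} (hmeas : ∀ k, 1 ≤ k → Measurable (Y k))
    (hident : ∀ k : ℕ, 1 ≤ k → IdentDistrib (Y k) (Y 1) μ μ)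
    {C : ℝ} (hsum : ∀ n : ℕ, ∑ j ∈ Finset.Icc 1 n, ∑ k ∈ Finset.Ico 1 j,
      cov[fun ω => ramp (k / 2) k (Y k ω), fun ω => ramp (j / 2) j (Y j ω); μ] /
        ((k : ℝ) * j) ≤ C)
    (hlim : ∀ᵐ ω ∂μ, Tendsto (fun k : ℕ => Y k ω / k) atTop (𝓝 0)) :
    Integrable (fun ω => max (Y 1 ω) 0) μ := by
  have hmW : ∀ k : ℕ, Measurable fun t => ramp ((k : ℝ) / 2) k t / (k / 2) := fun k =>
    (measurable_ramp _ _).div_const _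
  have hW0 : ∀ (k : ℕ) (t : ℝ), 0 ≤ ramp ((k : ℝ) / 2) k t / (k / 2) := fun k t =>
    div_nonneg (ramp_nonneg _ _ _) (by positivity)
  obtain ⟨K, hK⟩ := exists_sum_integral_le_of_ae_eventually_eq_zero (μ := μ)
    (W := fun k ω => ramp (k / 2) k (Y k ω) / (k / 2)) (C := 4 * C)
    (fun k hk => (hmW k).comp (hmeas k hk)) (fun k _ ω => hW0 k _)
    (fun k hk ω => by
      have hk0 : (0 : ℝ) < k := by exact_mod_cast hk
      refine div_le_one_of_le₀ ((ramp_le (by linarith) _).trans_eq (by ring)) (by positivity))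
    (fun n => by
      refine le_trans (le_of_eq ?_) (mul_le_mul_of_nonneg_left (hsum n) zero_le_four)
      simp_rw [Finset.mul_sum]
      refine Finset.sum_congr rfl fun j _ => Finset.sum_congr rfl fun k _ => ?_
      rw [covariance_fun_div_left, covariance_fun_div_right]
      field_simp
      ring)
    (by
      filter_upwards [hlim] with ω hω
      filter_upwards [hω.eventually_lt_const (by norm_num : (0 : ℝ) < 1 / 2),
        eventually_ge_atTop 1] with k hk hk1
      have hk0 : (0 : ℝ) < k := by exact_mod_cast hk1
      rw [div_lt_iff₀ hk0] at hk
      have : ramp ((k : ℝ) / 2) k (Y k ω) = 0 :=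
        max_eq_right (by linarith [min_le_left (Y k ω) (k : ℝ)])
      rw [this, zero_div])
  have hK' : ∀ n : ℕ, ∑ k ∈ Finset.Icc 1 n, ∫ ω, ramp (k / 2) k (Y 1 ω) / (k / 2) ∂μ ≤ K := by
    intro n
    refine le_trans (le_of_eq (Finset.sum_congr rfl fun k hk => ?_)) (hK n)
    exact (((hident k (Finset.mem_Icc.1 hk).1).comp (hmW k)).integral_eq).symm
  have hY := hmeas 1 le_rfl
  have hWint : ∀ k : ℕ, Integrable (fun ω => ramp (k / 2) k (Y 1 ω) / (k / 2)) μ := fun k =>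
    ((memLp_ramp (by linarith [k.cast_nonneg (α := ℝ)]) hY 1).integrable le_rfl).div_const _
  refine ⟨(hY.max measurable_const).aestronglyMeasurable, ?_⟩
  have hpos : 0 ≤ᵐ[μ] fun ω => max (Y 1 ω) 0 := ae_of_all _ fun ω => le_max_right _ _
  rw [hasFiniteIntegral_iff_ofReal hpos]
  -- Monotone convergence along the truncations `min (max (Y 1) 0) (n + 1)`.
  have hmono : ∀ ω, Monotone fun n : ℕ => ENNReal.ofReal (min (max (Y 1 ω) 0) ((n : ℝ) + 1)) :=
    fun ω n m hnm => ENNReal.ofReal_le_ofReal (min_le_min_left _ (by gcongr))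
  have hsup : ∀ ω, ENNReal.ofReal (max (Y 1 ω) 0) ≤
      ⨆ n : ℕ, ENNReal.ofReal (min (max (Y 1 ω) 0) ((n : ℝ) + 1)) := by
    intro ω
    obtain ⟨n, hn⟩ := exists_nat_ge (max (Y 1 ω) 0)
    refine le_iSup_of_le n ?_
    rw [min_eq_left (by linarith)]
  refine lt_of_le_of_lt (lintegral_mono hsup) ?_
  rw [lintegral_iSup (fun n => ((hY.max measurable_const).min measurable_const).ennreal_ofReal)
    fun n m hnm ω => hmono ω hnm]
  refine lt_of_le_of_lt (iSup_le fun n => ?_) (ENNReal.ofReal_lt_top (r := 1 + K))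
  have hmaj : Integrable (fun ω => 1 + ∑ k ∈ Finset.Icc 1 n, ramp (k / 2) k (Y 1 ω) / (k / 2)) μ :=
    (integrable_const _).add (integrable_finsetSum _ fun k _ => hWint k)
  calc _ ≤ ∫⁻ ω, ENNReal.ofReal
        (1 + ∑ k ∈ Finset.Icc 1 n, ramp (k / 2) k (Y 1 ω) / (k / 2)) ∂μ :=
        lintegral_mono fun ω => ENNReal.ofReal_le_ofReal (min_max_le_sum_ramp_div _ n)
    _ = ENNReal.ofReal (∫ ω, 1 + ∑ k ∈ Finset.Icc 1 n, ramp (k / 2) k (Y 1 ω) / (k / 2) ∂μ) :=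
        (ofReal_integral_eq_lintegral_ofReal hmaj (ae_of_all _ fun ω =>
          add_nonneg zero_le_one (Finset.sum_nonneg fun k _ => hW0 k _))).symm
    _ ≤ _ := by
        refine ENNReal.ofReal_le_ofReal ?_
        rw [integral_add (integrable_const _) (integrable_finsetSum _ fun k _ => hWint k),
          integral_finsetSum _ fun k _ => hWint k]
        simpa using hK' n

end Ramps

/-! ### The strong law and its converse -/

theorem corollary2 {Ω : Type*} [MeasurableSpace Ω] (μ : Measure Ω) [IsProbabilityMeasure μ]
    (X : ℕ → Ω → ℝ)
    (hmeas : ∀ k : ℕ, 1 ≤ k → Measurable (X k))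
    (hident : ∀ k : ℕ, 1 ≤ k → IdentDistrib (X k) (X 1) μ μ)
    (hpqd : PairwisePQD μ X)
    (hsum : Summable fun p : {p : ℕ × ℕ // 1 ≤ p.1 ∧ p.1 < p.2} =>
      quadrantG μ (X p.1.1) (X p.1.2) (p.1.1 : ℝ) (p.1.2 : ℝ) / ((p.1.1 : ℝ) * (p.1.2 : ℝ))) :
    (Integrable (X 1) μ ↔
      ∀ᵐ ω ∂μ, Tendsto
        (fun n : ℕ => (∑ k ∈ Finset.Icc 1 n, (X k ω - ∫ ω', X 1 ω' ∂μ)) / (n : ℝ))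
        atTop (𝓝 0)) ∧
    (∀ c : ℝ,
      (∀ᵐ ω ∂μ, Tendsto
        (fun n : ℕ => (∑ k ∈ Finset.Icc 1 n, (X k ω - c)) / (n : ℝ)) atTop (𝓝 0)) →
      Integrable (X 1) μ ∧ ∫ ω, X 1 ω ∂μ = c) := by
  have hΔ : ∀ k j, 1 ≤ k → k < j → ∀ x y, 0 ≤ quadrantDelta μ (X k) (X j) x y := by
    intro k j hk hkj x y
    rw [quadrantDelta_eq (hmeas k hk) (hmeas j (by omega))]
    exact hpqd k j hk (by omega) hkj.ne x y
  have hcov : ∀ k j : ℕ, 1 ≤ k → k < j → ∀ a b c d : ℝ, -k ≤ a → a ≤ b → b ≤ k → -j ≤ c → c ≤ d →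
      d ≤ j → 0 ≤ cov[fun ω => ramp a b (X k ω), fun ω => ramp c d (X j ω); μ] ∧
        cov[fun ω => ramp a b (X k ω), fun ω => ramp c d (X j ω); μ] ≤
          quadrantG μ (X k) (X j) k j := by
    intro k j hk hkj a b c d ha hab hb hc hcd hd
    have hj : 1 ≤ j := by omega
    exact ⟨covariance_ramp_nonneg (hmeas k hk) (hmeas j hj) (hΔ k j hk hkj) hab hcd,
      covariance_ramp_le_quadrantG (hmeas k hk) (hmeas j hj) (hΔ k j hk hkj) hab hcd ha hb hc hd⟩
  obtain ⟨C, hC⟩ := exists_sum_le_of_summable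
    (f := fun k j => quadrantG μ (X k) (X j) k j / ((k : ℝ) * j)) (fun k j hk hkj => by
      obtain ⟨h1, h2⟩ := hcov k j hk hkj 0 0 0 0 (by simp) le_rfl (by simp) (by simp) le_rfl
        (by simp)
      exact div_nonneg (h1.trans h2) (by positivity)) hsum
  -- Every family of covariances dominated by `quadrantG` inherits the bound `C`.
  have hdom : ∀ r : ℕ → ℕ → ℝ, (∀ k j, 1 ≤ k → k < j → r k j ≤ quadrantG μ (X k) (X j) k j) →
      ∀ n : ℕ, ∑ j ∈ Finset.Icc 1 n, ∑ k ∈ Finset.Ico 1 j, r k j / ((k : ℝ) * j) ≤ C := by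
    intro r hr n
    refine le_trans (Finset.sum_le_sum fun j _ => Finset.sum_le_sum fun k hk => ?_) (hC n)
    obtain ⟨h1, h2⟩ := Finset.mem_Ico.1 hk
    exact div_le_div_of_nonneg_right (hr k j h1 h2) (by positivity)
  have hneg_meas : ∀ k, 1 ≤ k → Measurable fun ω => -X k ω := fun k hk => (hmeas k hk).neg
  have hneg_ident : ∀ k, 1 ≤ k → IdentDistrib (fun ω => -X k ω) (fun ω => -X 1 ω) μ μ :=
    fun k hk => (hident k hk).comp measurable_neg
  have hcov_neg : ∀ k j : ℕ, 1 ≤ k → k < j → ∀ a b c d : ℝ, 0 ≤ a → a ≤ b → b ≤ k → 0 ≤ c →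
      c ≤ d → d ≤ j → 0 ≤ cov[fun ω => ramp a b (-X k ω), fun ω => ramp c d (-X j ω); μ] ∧
        cov[fun ω => ramp a b (-X k ω), fun ω => ramp c d (-X j ω); μ] ≤
          quadrantG μ (X k) (X j) k j := by
    intro k j hk hkj a b c d ha hab hb hc hcd hd
    rw [covariance_ramp_neg (hmeas k hk) (hmeas j (by omega)) hab hcd]
    have hk0 : (0 : ℝ) ≤ k := k.cast_nonneg
    have hj0 : (0 : ℝ) ≤ j := j.cast_nonneg
    exact hcov k j hk hkj _ _ _ _ (by linarith) (by linarith) (by linarith) (by linarith)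
      (by linarith) (by linarith)
  have hforward : Integrable (X 1) μ → ∀ᵐ ω ∂μ, Tendsto
      (fun n : ℕ => (∑ k ∈ Finset.Icc 1 n, X k ω) / (n : ℝ)) atTop (𝓝 (∫ ω, X 1 ω ∂μ)) := by
    intro hint
    have h1 := strong_law_positive_part hmeas hident hint
      (fun k j hk hkj => (hcov k j hk hkj 0 k 0 j (by simp) (by simp) le_rfl (by simp) (by simp)
        le_rfl).1)
      (hdom _ fun k j hk hkj => (hcov k j hk hkj 0 k 0 j (by simp) (by simp) le_rfl (by simp)
        (by simp) le_rfl).2)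
    have h2 := strong_law_positive_part hneg_meas hneg_ident hint.neg
      (fun k j hk hkj => (hcov_neg k j hk hkj 0 k 0 j le_rfl (by simp) le_rfl le_rfl (by simp)
        le_rfl).1)
      (hdom _ fun k j hk hkj => (hcov_neg k j hk hkj 0 k 0 j le_rfl (by simp) le_rfl le_rfl
        (by simp) le_rfl).2)
    have hsplit : ∀ t : ℝ, max t 0 - max (-t) 0 = t := fun t => by
      rcases le_total t 0 with h | h
      · rw [max_eq_right h, max_eq_left (by linarith)]; ring
      · rw [max_eq_left h, max_eq_right (by linarith)]; ring
    have hE : ∫ ω, X 1 ω ∂μ = ∫ ω, max (X 1 ω) 0 ∂μ - ∫ ω, max (-X 1 ω) 0 ∂μ := by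
      rw [← integral_sub hint.pos_part hint.neg_part]
      simp_rw [hsplit]
    rw [hE]
    filter_upwards [h1, h2] with ω h3 h4
    refine (h3.sub h4).congr fun n => ?_
    rw [← sub_div, ← Finset.sum_sub_distrib]
    simp_rw [hsplit]
  have hcenter : ∀ (c : ℝ) (ω : Ω) (n : ℕ), n ≠ 0 →
      (∑ k ∈ Finset.Icc 1 n, (X k ω - c)) / (n : ℝ) = (∑ k ∈ Finset.Icc 1 n, X k ω) / n - c := by
    intro c ω n hn
    have : (n : ℝ) ≠ 0 := by exact_mod_cast hn
    rw [Finset.sum_sub_distrib, sub_div]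
    simp [this]
  have hbackward : ∀ c : ℝ, (∀ᵐ ω ∂μ, Tendsto
      (fun n : ℕ => (∑ k ∈ Finset.Icc 1 n, (X k ω - c)) / (n : ℝ)) atTop (𝓝 0)) →
      Integrable (X 1) μ := by
    intro c hc
    have hlim : ∀ᵐ ω ∂μ, Tendsto (fun k : ℕ => X k ω / k) atTop (𝓝 0) := by
      filter_upwards [hc] with ω hω using tendsto_div_of_tendsto_sum_Icc_div hω
    have hlim' : ∀ᵐ ω ∂μ, Tendsto (fun k : ℕ => -X k ω / k) atTop (𝓝 0) := by
      filter_upwards [hlim] with ω hω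
      simpa [neg_div] using hω.neg
    have hhalf : ∀ k : ℕ, (k : ℝ) / 2 ≤ k := fun k => by linarith [k.cast_nonneg (α := ℝ)]
    have hhalf0 : ∀ k : ℕ, (0 : ℝ) ≤ (k : ℝ) / 2 := fun k => by positivity
    have hhalf' : ∀ k : ℕ, -(k : ℝ) ≤ (k : ℝ) / 2 := fun k => by
      linarith [k.cast_nonneg (α := ℝ)]
    have h1 := integrable_positive_part hmeas hident
      (hdom _ fun k j hk hkj => (hcov k j hk hkj _ _ _ _ (hhalf' k) (hhalf k) le_rfl (hhalf' j)
        (hhalf j) le_rfl).2) hlim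
    have h2 := integrable_positive_part hneg_meas hneg_ident
      (hdom _ fun k j hk hkj => (hcov_neg k j hk hkj _ _ _ _ (hhalf0 k) (hhalf k) le_rfl (hhalf0 j)
        (hhalf j) le_rfl).2) hlim'
    refine (h1.add h2).mono' (hmeas 1 le_rfl).aestronglyMeasurable (ae_of_all _ fun ω => ?_)
    exact abs_le'.2 ⟨(le_max_left (X 1 ω) 0).trans (le_add_of_nonneg_right (le_max_right _ _)),
      (le_max_left (-X 1 ω) 0).trans (le_add_of_nonneg_left (le_max_right _ _))⟩
  refine ⟨⟨fun hint => ?_, hbackward _⟩, fun c hc => ⟨hbackward c hc, ?_⟩⟩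
  · filter_upwards [hforward hint] with ω hω
    have h := hω.sub_const (∫ ω, X 1 ω ∂μ)
    rw [sub_self] at h
    refine h.congr' ?_
    filter_upwards [eventually_ne_atTop 0] with n hn
    exact (hcenter _ ω n hn).symm
  · obtain ⟨ω, h1, h2⟩ := ((hforward (hbackward c hc)).and hc).exists
    have h3 : Tendsto (fun n : ℕ => (∑ k ∈ Finset.Icc 1 n, X k ω) / (n : ℝ)) atTop (𝓝 c) := by
      have h := h2.add_const c
      rw [zero_add] at h
      refine h.congr' ?_
      filter_upwards [eventually_ne_atTop 0] with n hn
      rw [hcenter _ ω n hn, sub_add_cancel]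
    exact tendsto_nhds_unique h1 h3
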